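/- Let $G$ be a group and let $Q=\mathrm{Core}(G)$ be its core quandle, i.e. the set $G$ with the operation $x*y=xy^{-1}x$. Then the following are equivalent. (i) $Q$ is abelian in the sense of commutator theory, i.e. $[1_Q,1_Q]=0_Q$. Here $1_Q$ is the total congruence on $Q$, $0_Q$ is equality, quandles are regarded as algebras with the two binary operations $*$ and left division $\backslash$ (given by $x\backslash y=L_x^{-1}(y)$, where $L_x(y)=x*y$), and, for congruences $\alpha,\beta$, the commutator $[\alpha,\beta]$ is the least congruence $\delta$ such that for every term $t(x_1,\dots,x_m,y_1,\dots,y_n)$, all $a_i\mathrel{\alpha}b_i$ and all $u_j\mathrel{\beta}v_j$, $$t(a,u)\mathrel{\delta}t(a,v)\ \Longrightarrow\ t(b,u)\mathrel{\delta}t(b,v).$$ (ii) $G$ is nilpotent of class at most $2$, and for every finite sequence $x_1,\dots,x_t$ of elements of $G$, if $x_1x_2\cdots x_t=(x_t\cdots x_2x_1)^{-1}$, then $x_1x_2\cdots x_t\in Z(G)$. -/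

import Mathlib

namespace UnivAlg

open FirstOrder

variable (L : Language) {A : Type*} [L.Structure A]

/-- An equivalence relation compatible with all basic operations of the algebra `A`. -/
def IsCongruence (δ : Setoid A) : Prop :=
  ∀ (n : ℕ) (f : L.Functions n) (x y : Fin n → A),
    (∀ i, δ (x i) (y i)) → δ (Language.Structure.funMap f x) (Language.Structure.funMap f y)

/-- The term condition `C(α, β; δ)`: for every term `t(x₁,…,xₘ,y₁,…,yₙ)`, all tuples
`a α b` and all tuples `u β v`, if `t(a,u) δ t(a,v)` then `t(b,u) δ t(b,v)`. -/
def Centralizes (α β δ : Setoid A) : Prop :=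
  ∀ (m n : ℕ) (t : L.Term (Fin m ⊕ Fin n)) (a b : Fin m → A) (u v : Fin n → A),
    (∀ i, α (a i) (b i)) → (∀ j, β (u j) (v j)) →
    δ (t.realize (Sum.elim a u)) (t.realize (Sum.elim a v)) →
    δ (t.realize (Sum.elim b u)) (t.realize (Sum.elim b v))

/-- The commutator `[α, β]`: the least congruence `δ` such that `C(α, β; δ)` holds
(the defining family is closed under intersections, and `sInf` of setoids is intersection). -/
def commutator (α β : Setoid A) : Setoid A :=
  sInf {δ | IsCongruence L δ ∧ Centralizes L α β δ}

variable (A) in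
/-- The algebra `A` is abelian: `[1_A, 1_A] = 0_A`, where `1_A` is the total congruence `⊤` and
`0_A` is equality `⊥`. -/
def IsAbelianAlgebra : Prop :=
  commutator L (⊤ : Setoid A) (⊤ : Setoid A) = ⊥

end UnivAlg

namespace Quandle

/-- The operation symbols of quandles: the binary operation `*` and left division. -/
inductive OpSymbol : ℕ → Type
  | act : OpSymbol 2
  | ldiv : OpSymbol 2

/-- The algebraic signature of quandles. -/
def sig : FirstOrder.Language.{0, 0} where
  Functions := OpSymbol
  Relations := fun _ => Empty

/-- Every quandle is an algebra in the signature `(*, \)`. -/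
instance sigStructure (Q : Type*) [Quandle Q] : sig.Structure Q where
  funMap := fun f x =>
    match f, x with
    | OpSymbol.act, x => Shelf.act (x 0) (x 1)
    | OpSymbol.ldiv, x => Rack.invAct (x 0) (x 1)
  RelMap := fun r _ => nomatch r

/-- A quandle is abelian in the sense of commutator theory. (This differs from
`Rack.IsAbelian`, which is mediality.) -/
def IsAbelianQuandle (Q : Type*) [Quandle Q] : Prop :=
  UnivAlg.IsAbelianAlgebra sig Q

/-- The underlying set of the core quandle of `G`. -/
def Core (G : Type*) : Type _ := G

/-- `Core(G)`: the set `G` with `x * y = x y⁻¹ x`. It is involutory, so that left division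
coincides with `*`. -/
instance instQuandleCore (G : Type*) [Group G] : Quandle (Core G) where
  act := fun (x y : G) => (x * y⁻¹ * x : G)
  invAct := fun (x y : G) => (x * y⁻¹ * x : G)
  self_distrib := by
    intro (x : G) (y : G) (z : G)
    change (x * (y * z⁻¹ * y)⁻¹ * x : G)
      = (x * y⁻¹ * x) * (x * z⁻¹ * x)⁻¹ * (x * y⁻¹ * x)
    group
  left_inv := by
    intro (x : G) (y : G)
    change (x * (x * y⁻¹ * x)⁻¹ * x : G) = y
    group
  right_inv := by
    intro (x : G) (y : G)
    change (x * (x * y⁻¹ * x)⁻¹ * x : G) = y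
    group
  fix := by
    intro (x : G)
    change (x * x⁻¹ * x : G) = x
    group

end Quandle

open scoped commutatorElement

namespace UnivAlg

open FirstOrder

/-! Write `L_x` for the reflection `y ↦ x y⁻¹ x`. Since `L_x² = 1` and `L_{W y} = W L_y W⁻¹` for
every product `W` of reflections, each term is a word of reflections in its variables applied to one
variable (`exists_realize_eq_reflectionWord`). Evaluating the same word at two assignments gives
permutations that differ by a displacement `z ↦ x₁⋯xₜ z xₜ⋯x₁`. In class two, the displacement
caused by changing `a` to `b` is independent of the `y`-variables (`reflectionWord_mul_inv_eq`); the
word condition makes a displacement with a fixed point trivial. Together these give the term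
condition. Conversely, two explicit families of terms force the two conditions on `G`. -/

/-- An algebra is abelian iff the term condition `C(1, 1; 0)` holds. -/
theorem isAbelianAlgebra_iff (L : Language) (A : Type*) [L.Structure A] :
    IsAbelianAlgebra L A ↔ Centralizes L (⊤ : Setoid A) ⊤ ⊥ := by
  constructor
  · intro h m n t a b u v hab huv heq
    unfold IsAbelianAlgebra at h
    rw [← h] at heq ⊢
    exact fun δ hδ => hδ.2 m n t a b u v hab huv (heq δ hδ)
  · intro h
    refine le_bot_iff.mp (sInf_le ⟨?_, h⟩)
    intro n f x y hxy
    have : x = y := funext hxy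
    subst this
    exact Setoid.refl' _ _

end UnivAlg

namespace Quandle

open FirstOrder

/-! ### Terms as words of reflections. -/

section Terms

variable {V : Type*}

/-- The term `s * r`. -/
def actTerm (s r : sig.Term V) : sig.Term V :=
  Language.Term.func (L := sig) (l := 2) OpSymbol.act ![s, r]

variable {G : Type*} [Group G]

/-- Left translation by `x` in the core quandle, as a permutation of `G`. -/
def coreReflection (x : G) : Equiv.Perm G where
  toFun y := x * y⁻¹ * x
  invFun y := x * y⁻¹ * x
  left_inv y := by group
  right_inv y := by group

theorem coreReflection_apply (x y : G) : coreReflection x y = x * y⁻¹ * x := rfl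

theorem coreReflection_inv (x : G) : (coreReflection x)⁻¹ = coreReflection x := rfl

/-- The value in `Core G` of a term, as an element of `G`. -/
def coreRealize (t : sig.Term V) (f : V → G) : G := t.realize (M := Core G) f

@[simp] theorem coreRealize_var (i : V) (f : V → G) :
    coreRealize (Language.Term.var i) f = f i := rfl

@[simp] theorem coreRealize_actTerm (s r : sig.Term V) (f : V → G) :
    coreRealize (actTerm s r) f = coreReflection (coreRealize s f) (coreRealize r f) := by
  rfl

/-- The composite of the left translations by the values of the variables in `ℓ`. -/
def reflectionWord (ℓ : List V) (f : V → G) : Equiv.Perm G :=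
  (ℓ.map fun i => coreReflection (f i)).prod

@[simp] theorem reflectionWord_nil (f : V → G) : reflectionWord [] f = 1 := rfl

@[simp] theorem reflectionWord_cons (i : V) (ℓ : List V) (f : V → G) :
    reflectionWord (i :: ℓ) f = coreReflection (f i) * reflectionWord ℓ f := by
  simp [reflectionWord]

@[simp] theorem reflectionWord_append (ℓ₁ ℓ₂ : List V) (f : V → G) :
    reflectionWord (ℓ₁ ++ ℓ₂) f = reflectionWord ℓ₁ f * reflectionWord ℓ₂ f := by
  simp [reflectionWord]

theorem reflectionWord_reverse (ℓ : List V) (f : V → G) :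
    reflectionWord ℓ.reverse f = (reflectionWord ℓ f)⁻¹ := by
  induction ℓ with
  | nil => simp
  | cons i ℓ ih => simp [ih, coreReflection_inv]

theorem coreReflection_map (ℓ : List V) (f : V → G) (x : G) :
    coreReflection (reflectionWord ℓ f x)
      = reflectionWord ℓ f * coreReflection x * (reflectionWord ℓ f)⁻¹ := by
  induction ℓ with
  | nil => simp
  | cons i ℓ ih =>
    have key (g y : G) : coreReflection (coreReflection g y)
        = coreReflection g * coreReflection y * (coreReflection g)⁻¹ := by
      ext z
      simp only [coreReflection_inv, Equiv.Perm.mul_apply, coreReflection_apply]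
      group
    simp only [reflectionWord_cons, Equiv.Perm.mul_apply, key, ih]
    group

/-- In a core quandle every term is a product of left translations by variables applied to a
variable. -/
theorem exists_realize_eq_reflectionWord (t : sig.Term V) :
    ∃ (ℓ : List V) (i : V), ∀ f : V → G,
      coreRealize t f = reflectionWord ℓ f (f i) := by
  induction t with
  | var i => exact ⟨[], i, fun f => rfl⟩
  | @func n op ts ih =>
    have main (s r : sig.Term V)
        (hs : ∃ (ℓ : List V) (i : V), ∀ f : V → G,
          coreRealize s f = reflectionWord ℓ f (f i))
        (hr : ∃ (ℓ : List V) (i : V), ∀ f : V → G,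
          coreRealize r f = reflectionWord ℓ f (f i)) :
        ∃ (ℓ : List V) (i : V), ∀ f : V → G,
          coreReflection (coreRealize s f) (coreRealize r f)
            = reflectionWord ℓ f (f i) := by
      obtain ⟨ℓs, i, hs⟩ := hs
      obtain ⟨ℓr, j, hr⟩ := hr
      -- For `s = W x_i` the reflection in `s` is `W L_{x_i} W⁻¹`, and `W⁻¹` is the reversed word.
      refine ⟨ℓs ++ [i] ++ ℓs.reverse ++ ℓr, j, fun f => ?_⟩
      rw [hs, hr, coreReflection_map]
      simp [reflectionWord_reverse]
    cases op with
    | act => exact main (ts 0) (ts 1) (ih 0) (ih 1)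
    | ldiv => exact main (ts 0) (ts 1) (ih 0) (ih 1)

end Terms

variable {G : Type*} [Group G]

/-- The term condition for core quandles, stated for values in `G`. -/
theorem isAbelianQuandle_core_iff :
    IsAbelianQuandle (Core G) ↔
      ∀ (m n : ℕ) (t : sig.Term (Fin m ⊕ Fin n)) (a b : Fin m → G) (u v : Fin n → G),
        coreRealize t (Sum.elim a u) = coreRealize t (Sum.elim a v) →
        coreRealize t (Sum.elim b u) = coreRealize t (Sum.elim b v) := by
  rw [IsAbelianQuandle, UnivAlg.isAbelianAlgebra_iff]
  exact ⟨fun h m n t a b u v => h m n t a b u v (fun _ => trivial) (fun _ => trivial),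
    fun h m n t a b u v _ _ => h m n t a b u v⟩

/-! ### Displacements, and sufficiency of the group conditions. -/

/-- The displacements of the core quandle: the maps `z ↦ x₁ ⋯ xₜ z xₜ ⋯ x₁`. -/
def IsCoreDisplacement (D : Equiv.Perm G) : Prop :=
  ∃ l : List G, ∀ z, D z = l.prod * z * l.reverse.prod

theorem isCoreDisplacement_one : IsCoreDisplacement (1 : Equiv.Perm G) :=
  ⟨[], fun z => by simp⟩

theorem prod_map_inv_eq (l : List G) : (l.map (·⁻¹)).prod = l.reverse.prod⁻¹ := by
  simp [List.prod_inv_reverse]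

theorem IsCoreDisplacement.conj {D : Equiv.Perm G} (hD : IsCoreDisplacement D) (x y : G) :
    IsCoreDisplacement (coreReflection x * D * coreReflection y) := by
  obtain ⟨l, hl⟩ := hD
  refine ⟨x :: (l.map (·⁻¹) ++ [y⁻¹]), fun z => ?_⟩
  have h2 : (l.map (·⁻¹)).reverse.prod = l.prod⁻¹ := by
    rw [← List.map_reverse, prod_map_inv_eq, List.reverse_reverse]
  simp only [Equiv.Perm.mul_apply, coreReflection_apply, hl, List.prod_cons, List.prod_append,
    List.reverse_cons, List.reverse_append, prod_map_inv_eq, h2, List.prod_nil, List.reverse_nil,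
    List.nil_append]
  group

theorem isCoreDisplacement_reflectionWord_mul_inv {V : Type*} (ℓ : List V) (f g : V → G) :
    IsCoreDisplacement (reflectionWord ℓ f * (reflectionWord ℓ g)⁻¹) := by
  induction ℓ with
  | nil => simpa using isCoreDisplacement_one
  | cons i ℓ ih =>
    have := ih.conj (f i) (g i)
    simpa [mul_assoc, coreReflection_inv] using this


theorem exists_prod_eq_center_mul_reverse_prod
    (hG : ∀ x y : G, ⁅x, y⁆ ∈ Subgroup.center G) (l : List G) :
    ∃ c ∈ Subgroup.center G, l.prod = c * l.reverse.prod := by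
  induction l with
  | nil => exact ⟨1, one_mem _, by simp⟩
  | cons x l ih =>
    obtain ⟨c, hc, h⟩ := ih
    refine ⟨c * ⁅x, l.reverse.prod⁆, mul_mem hc (hG _ _), ?_⟩
    have hx := Subgroup.mem_center_iff.mp hc x
    simp only [List.prod_cons, List.reverse_cons, List.prod_append, List.prod_nil, h,
      commutatorElement_def]
    rw [← mul_assoc, hx]
    group

/-- The two conjugates are `⁅u, q⁆ q` and `⁅u, q⁆⁻¹ q`, so the central factors cancel. -/
theorem conj_mul_conj_inv_eq (hG : ∀ x y : G, ⁅x, y⁆ ∈ Subgroup.center G) (u q z : G) :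
    u * q * u⁻¹ * z * (u⁻¹ * q * u) = q * z * q := by
  have hk := Subgroup.mem_center_iff.mp (hG u q)
  have h1 : u * q * u⁻¹ = ⁅u, q⁆ * q := by rw [commutatorElement_def]; group
  have h2 : u⁻¹ * q * u = ⁅u, q⁆⁻¹ * q := by
    rw [eq_inv_mul_iff_mul_eq, ← mul_assoc, ← mul_assoc, ← hk u⁻¹, commutatorElement_def]
    group
  rw [h1, h2, ← hk q, mul_assoc q, ← hk z]
  group

/-- In class two, conjugation of displacements by a left translation does not depend on the
translation. -/
theorem IsCoreDisplacement.coreReflection_conj_eq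
    (hG : ∀ x y : G, ⁅x, y⁆ ∈ Subgroup.center G) {D : Equiv.Perm G}
    (hD : IsCoreDisplacement D) (u v : G) :
    coreReflection u * D * (coreReflection u)⁻¹ = coreReflection v * D * (coreReflection v)⁻¹ := by
  obtain ⟨l, hl⟩ := hD
  obtain ⟨c, hc, h⟩ := exists_prod_eq_center_mul_reverse_prod hG l
  have hc' := Subgroup.mem_center_iff.mp (inv_mem hc)
  have key (u z : G) : (coreReflection u * D * (coreReflection u)⁻¹) z
      = c⁻¹ * (l.reverse.prod⁻¹ * z * l.reverse.prod⁻¹) := by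
    rw [← conj_mul_conj_inv_eq hG u]
    simp only [Equiv.Perm.mul_apply, coreReflection_inv, coreReflection_apply, hl, h]
    have h3 := hc' (u * l.reverse.prod⁻¹ * u⁻¹ * z * u⁻¹ * l.reverse.prod⁻¹)
    calc _ = u * l.reverse.prod⁻¹ * u⁻¹ * z * u⁻¹ * l.reverse.prod⁻¹ * c⁻¹ * u := by group
      _ = _ := by rw [h3]; group
  ext z
  rw [key, key]

/-- In class two, the effect of changing the `x`-variables in a product of left translations does
not depend on the values of the `y`-variables. -/
theorem reflectionWord_mul_inv_eq (hG : ∀ x y : G, ⁅x, y⁆ ∈ Subgroup.center G)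
    {X Y : Type*} (ℓ : List (X ⊕ Y)) (a b : X → G) (u v : Y → G) :
    reflectionWord ℓ (Sum.elim b u) * (reflectionWord ℓ (Sum.elim a u))⁻¹
      = reflectionWord ℓ (Sum.elim b v) * (reflectionWord ℓ (Sum.elim a v))⁻¹ := by
  induction ℓ with
  | nil => simp
  | cons i ℓ ih =>
    have hD := isCoreDisplacement_reflectionWord_mul_inv ℓ (Sum.elim b v) (Sum.elim a v)
    have expand (w : Y → G) : reflectionWord (i :: ℓ) (Sum.elim b w)
        * (reflectionWord (i :: ℓ) (Sum.elim a w))⁻¹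
        = coreReflection (Sum.elim b w i)
          * (reflectionWord ℓ (Sum.elim b w) * (reflectionWord ℓ (Sum.elim a w))⁻¹)
          * (coreReflection (Sum.elim a w i))⁻¹ := by
      simp [mul_assoc]
    rw [expand, expand, ih]
    cases i with
    | inl i => rfl
    | inr j => exact hD.coreReflection_conj_eq hG (u j) (v j)

/-- If words that are inverse to their reversals are central, then displacements act
semiregularly. -/
theorem IsCoreDisplacement.eq_one_of_apply_eq
    (hl : ∀ l : List G, l.prod = (l.reverse.prod)⁻¹ → l.prod ∈ Subgroup.center G)
    {D : Equiv.Perm G} (hD : IsCoreDisplacement D) {z : G} (hz : D z = z) : D = 1 := by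
  obtain ⟨l, h⟩ := hD
  -- Replacing each letter `x` by `z⁻¹ x, z` conjugates the product by `z` but leaves the reversed
  -- product unchanged, which moves the fixed point from `z` to `1`.
  have h1 (l : List G) : (l.flatMap fun x => [z⁻¹ * x, z]).prod = z⁻¹ * l.prod * z := by
    induction l with
    | nil => simp
    | cons x l ih => simp only [List.flatMap_cons, List.prod_append, ih]; simp [mul_assoc]
  have h2 (l : List G) :
      (l.flatMap fun x => [z⁻¹ * x, z]).reverse.prod = l.reverse.prod := by
    induction l with
    | nil => simp
    | cons x l ih =>
      simp only [List.flatMap_cons, List.reverse_append, List.prod_append, ih]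
      simp
  have hp : z⁻¹ * l.prod * z = l.reverse.prod⁻¹ := by
    rw [h] at hz
    rw [eq_inv_iff_mul_eq_one, mul_assoc, mul_assoc, ← mul_assoc l.prod, hz, inv_mul_cancel]
  have hc := hl (l.flatMap fun x => [z⁻¹ * x, z]) (by rw [h1, h2, hp])
  rw [h1, hp] at hc
  have hc' := Subgroup.mem_center_iff.mp hc
  have hp' : l.prod = l.reverse.prod⁻¹ := by
    have := hc' z
    rw [← hp] at this
    rw [← hp]
    calc l.prod = z * (z⁻¹ * l.prod * z) * z⁻¹ := by group
      _ = _ := by rw [this]; group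
  ext y
  rw [h, hp', ← hc' y]
  simp

theorem isAbelianQuandle_core_of_class_two (hG : ∀ x y : G, ⁅x, y⁆ ∈ Subgroup.center G)
    (hl : ∀ l : List G, l.prod = (l.reverse.prod)⁻¹ → l.prod ∈ Subgroup.center G) :
    IsAbelianQuandle (Core G) := by
  rw [isAbelianQuandle_core_iff]
  intro m n t a b u v h
  obtain ⟨ℓ, i, ht⟩ := exists_realize_eq_reflectionWord (G := G) t
  simp only [ht] at h ⊢
  have hw := reflectionWord_mul_inv_eq hG ℓ a b u v
  cases i with
  | inl i =>
    simp only [Sum.elim_inl] at h ⊢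
    -- The displacement from `u` to `v` has a fixed point by `h`, hence is trivial.
    have h1 : reflectionWord ℓ (Sum.elim a v) = reflectionWord ℓ (Sum.elim a u) := by
      have hD := isCoreDisplacement_reflectionWord_mul_inv ℓ (Sum.elim a v) (Sum.elim a u)
      rw [← mul_inv_eq_one]
      refine hD.eq_one_of_apply_eq hl (z := reflectionWord ℓ (Sum.elim a u) (a i)) ?_
      simp [← h]
    rw [h1] at hw
    rw [mul_right_cancel hw]
  | inr j =>
    simp only [Sum.elim_inr] at h ⊢
    -- Both sides of `hw` are applied to the common value given by `h`.
    have e1 := Equiv.Perm.congr_fun hw (reflectionWord ℓ (Sum.elim a u) (u j))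
    nth_rw 2 [h] at e1
    simpa using e1

/-! ### Necessity of the group conditions. -/

theorem commutatorElement_mem_center_of_isAbelianQuandle_core
    (h : IsAbelianQuandle (Core G)) (x y : G) : ⁅x, y⁆ ∈ Subgroup.center G := by
  rw [isAbelianQuandle_core_iff] at h
  -- With `D = L_{y⁻¹} L_1` the term is `L_b D L_b D z`. At `b = 1` it equals `z`, as it does when
  -- `D = 1`; at `b = x` it is `⁅x, y⁆ z (y⁻¹ x⁻¹ y x)`.
  have key (z : G) := h 1 5
    (let b := Language.Term.var (Sum.inl 0)
     let u (i : Fin 5) := Language.Term.var (Sum.inr i)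
     actTerm b (actTerm (u 0) (actTerm (u 1) (actTerm b (actTerm (u 2) (actTerm (u 3) (u 4)))))))
    ![1] ![x] ![y⁻¹, 1, y⁻¹, 1, z] ![1, 1, 1, 1, z] (by simp [coreReflection_apply, mul_assoc])
  have key' (z : G) : ⁅x, y⁆ * z * (y⁻¹ * x⁻¹ * y * x) = z := by
    simpa [coreReflection_apply, mul_assoc, commutatorElement_def] using key z
  have h1 := key' 1
  rw [mul_one, ← inv_eq_iff_mul_eq_one] at h1
  refine Subgroup.mem_center_iff.mpr fun z => ?_
  have := key' z
  rw [← h1, mul_inv_eq_iff_eq_mul] at this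
  exact this.symm

/-- The term `x₁ * (1 * (x₂ * (1 * ⋯ z)))`, in which the variables `xᵢ` are the `y`-variables. -/
def displacementTerm {n : ℕ} (l : List (Fin n)) : sig.Term (Fin 2 ⊕ Fin n) :=
  l.foldr (fun i r => actTerm (.var (Sum.inr i)) (actTerm (.var (Sum.inl 1)) r)) (.var (Sum.inl 0))

theorem coreRealize_displacementTerm {n : ℕ} (l : List (Fin n)) (z : G) (u : Fin n → G) :
    coreRealize (displacementTerm l) (Sum.elim ![z, 1] u)
      = (l.map u).prod * z * (l.map u).reverse.prod := by
  induction l with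
  | nil => simp [displacementTerm]
  | cons i l ih =>
    have : displacementTerm (i :: l)
      = actTerm (.var (Sum.inr i)) (actTerm (.var (Sum.inl 1)) (displacementTerm l)) := rfl
    simp [this, ih, coreReflection_apply, mul_assoc]

theorem prod_mem_center_of_isAbelianQuandle_core (h : IsAbelianQuandle (Core G))
    (l : List G) (hl : l.prod = (l.reverse.prod)⁻¹) : l.prod ∈ Subgroup.center G := by
  rw [isAbelianQuandle_core_iff] at h
  -- The displacement of `l` fixes `1` by `hl`; the term condition moves the base point from `1` to
  -- any `z`.
  have key (z : G) := h 2 l.length (displacementTerm (List.finRange l.length)) ![1, 1] ![z, 1]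
    l.get (fun _ => 1)
  simp only [coreRealize_displacementTerm, List.map_get_finRange] at key
  refine Subgroup.mem_center_iff.mpr fun z => ?_
  have hz := key z (by simp [hl])
  rw [hl] at hz ⊢
  simp only [List.map_const', List.reverse_replicate, List.prod_replicate, one_pow, one_mul,
    mul_one] at hz
  rw [← eq_mul_inv_iff_mul_eq] at hz
  exact hz.symm

end Quandle

theorem class_le_two_iff {G : Type*} [Group G] :
    (Group.IsNilpotent G ∧ Group.nilpotencyClass G ≤ 2) ↔
      ∀ x y : G, ⁅x, y⁆ ∈ Subgroup.center G := by
  have h2 : Subgroup.upperCentralSeries G 2 = ⊤ ↔ ∀ x y : G, ⁅x, y⁆ ∈ Subgroup.center G := by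
    rw [Subgroup.eq_top_iff']
    simp only [Subgroup.mem_upperCentralSeries_succ_iff (n := 1), Subgroup.upperCentralSeries_one]
  rw [← h2]
  constructor
  · rintro ⟨_, h⟩
    exact Subgroup.upperCentralSeries_eq_top_iff_nilpotencyClass_le.mpr h
  · intro h
    have : Group.IsNilpotent G := ⟨2, h⟩
    exact ⟨this, Subgroup.upperCentralSeries_eq_top_iff_nilpotencyClass_le.mp h⟩

theorem mainTheorem4 {G : Type*} [Group G] :
    Quandle.IsAbelianQuandle (Quandle.Core G) ↔
      ((Group.IsNilpotent G ∧ Group.nilpotencyClass G ≤ 2) ∧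
        ∀ l : List G, l.prod = (l.reverse.prod)⁻¹ → l.prod ∈ Subgroup.center G) := by
  rw [class_le_two_iff]
  exact ⟨fun h => ⟨Quandle.commutatorElement_mem_center_of_isAbelianQuandle_core h,
    Quandle.prod_mem_center_of_isAbelianQuandle_core h⟩,
    fun h => Quandle.isAbelianQuandle_core_of_class_two h.1 h.2⟩
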